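/- Let $H,K\in(0,1)$ and let $B^{H,K}=(B^{H,K}_t)_{t\ge 0}$ be a bifractional Brownian motion, that is, a centered Gaussian process with (almost surely) continuous paths and covariance $$E\left(B^{H,K}_sB^{H,K}_t\right)=\frac{1}{2^K}\left(\left(t^{2H}+s^{2H}\right)^K-|t-s|^{2HK}\right),\qquad s,t\ge 0.$$ Let $\theta>0$ and let $X=(X_t)_{t\ge0}$ be the Ornstein–Uhlenbeck process driven by $B^{H,K}$, that is, the continuous solution of $X_0=0$, $dX_t=-\theta X_t\,dt+dB^{H,K}_t$, understood as $X_t=-\theta\int_0^tX_s\,ds+B^{H,K}_t$ for all $t\ge0$, almost surely. **Theorem.** Let $\theta>0$ and $H,K\in(0,1)$ with $HK\neq\frac12$. Then $X_t$ is square integrable for every $t\ge 0$, and there exists a constant $C>0$ depending only on $\theta$ and $H$ such that for all $t>2$, $$\left|E\left[X_t^2\right]-\frac{HK\,\Gamma(2HK)}{2^{K-1}\theta^{2HK}}\right|\le C\,t^{2HK-2},$$ and for all $s,t\ge0$ with $|t-s|>2$, $$E\left(X_tX_s\right)\le C\begin{cases}|t-s|^{2HK-2H-1}&\text{if }0<H<\frac12,\\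 |t-s|^{2HK-2}&\text{if }\frac12\le H<1.\end{cases}$$ -/

import Mathlib

open MeasureTheory ProbabilityTheory
open scoped NNReal

/-- `B = (B_t)_{t ≥ 0}` is a bifractional Brownian motion with parameters `H` and `K` under `P`:
a centered Gaussian process with covariance
`E[B_s B_t] = 2^{-K} ((t^{2H} + s^{2H})^K - |t - s|^{2HK})`, taken, as usual, in a version with
almost surely continuous paths. -/
structure IsBifractionalBrownianMotion {Ω : Type*} [MeasurableSpace Ω]
    (H K : ℝ) (B : ℝ≥0 → Ω → ℝ) (P : Measure Ω) : Prop where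
  isGaussianProcess : IsGaussianProcess B P
  integral_eq_zero : ∀ t : ℝ≥0, ∫ ω, B t ω ∂P = 0
  integral_mul : ∀ s t : ℝ≥0, ∫ ω, B s ω * B t ω ∂P =
    1 / (2 : ℝ) ^ K * (((t : ℝ) ^ (2 * H) + (s : ℝ) ^ (2 * H)) ^ K
      - |(t : ℝ) - (s : ℝ)| ^ (2 * H * K))
  continuous_paths : ∀ᵐ ω ∂P, Continuous fun t : ℝ≥0 => B t ω

/-- `X = (X_t)_{t ≥ 0}` is the (pathwise, continuous) solution of the Langevin equation
`X_0 = 0`, `dX_t = -θ X_t dt + dG_t`, that is, almost surely `X` has continuous paths and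
`X_t = -θ ∫_0^t X_s ds + G_t` for all `t ≥ 0`. -/
structure IsOrnsteinUhlenbeck {Ω : Type*} [MeasurableSpace Ω]
    (θ : ℝ) (G X : ℝ≥0 → Ω → ℝ) (P : Measure Ω) : Prop where
  initial : ∀ᵐ ω ∂P, X 0 ω = 0
  continuous_paths : ∀ᵐ ω ∂P, Continuous fun t : ℝ≥0 => X t ω
  integral_equation : ∀ᵐ ω ∂P, ∀ t : ℝ≥0,
    X t ω = -θ * (∫ s in (0 : ℝ)..(t : ℝ), X s.toNNReal ω) + G t ω

/-!
Solving the Langevin equation pathwise and integrating by parts, `X_t = ∫_0^t e^{-θ (t - u)} dB_u`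
becomes a continuous linear functional of the path of `B`. Applying it in both variables to the
covariance of `B` gives `E[X_t X_s]`, which therefore splits, up to the factor `2^{-K}`, into the
contributions of `(u^{2H} + v^{2H})^K` and of `-|u - v|^{2HK}`.

The first kernel has nonpositive rectangular increments, hence a nonpositive contribution; since its
mixed second derivative has size `t^{2HK - 2}` near `(t, t)` and the weights decay exponentially,
its contribution to `E[X_t²]` is `O(t^{2HK - 2})`. The second kernel is that of fractional Brownian
motion: it gives the limiting variance as a Gamma integral with a tail of the same order. For
`s < t` the path up to the midpoint of `s` and `t` contributes to `E[X_t X_s]` only an exponentially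
small multiple of a bounded covariance, and beyond the midpoint the mixed second difference of
`|u - v|^{2HK}` is of order `(t - s)^{2HK - 2}`.
-/

section PowerFunction

theorem rpow_le_one_add_sq {p x : ℝ} (hp : 0 ≤ p) (hp2 : p ≤ 2) (hx : 0 ≤ x) :
    x ^ p ≤ 1 + x ^ 2 := by
  rcases le_total x 1 with h | h
  · have := Real.rpow_le_one hx h hp
    linarith [sq_nonneg x]
  · have := Real.rpow_le_rpow_of_exponent_le h hp2
    rw [Real.rpow_two] at this
    linarith

theorem rpow_eq_rpow_sub_two_mul_sq {x : ℝ} (a : ℝ) (hx : 0 < x) :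
    x ^ a = x ^ (a - 2) * x ^ 2 := by
  rw [← Real.rpow_two, ← Real.rpow_add hx, sub_add_cancel]

theorem half_rpow_sub_two_le {a x : ℝ} (ha : 0 ≤ a) (hx : 0 ≤ x) :
    (x / 2) ^ (a - 2) ≤ 4 * x ^ (a - 2) := by
  rw [Real.div_rpow hx zero_le_two, div_eq_mul_inv, ← Real.rpow_neg zero_le_two, mul_comm]
  gcongr
  calc (2 : ℝ) ^ (-(a - 2)) ≤ 2 ^ (2 : ℝ) :=
        Real.rpow_le_rpow_of_exponent_le one_le_two (by linarith)
    _ = 4 := by norm_num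

theorem exp_neg_mul_mul_sq_le {c x : ℝ} (hc : 0 < c) (hx : 0 ≤ x) :
    Real.exp (-c * x) * x ^ 2 ≤ 2 / c ^ 2 := by
  have h := Real.pow_div_factorial_le_exp (c * x) (by positivity) 2
  rw [neg_mul, Real.exp_neg, inv_mul_eq_div, div_le_div_iff₀ (Real.exp_pos _) (by positivity)]
  norm_num [mul_pow] at h
  linarith

theorem exp_neg_mul_mul_rpow_le_rpow_sub_two {c x : ℝ} (a : ℝ) (hc : 0 < c) (hx : 0 < x) :
    Real.exp (-c * x) * x ^ a ≤ 2 / c ^ 2 * x ^ (a - 2) := by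
  rw [rpow_eq_rpow_sub_two_mul_sq a hx, mul_left_comm, mul_comm]
  gcongr
  exact exp_neg_mul_mul_sq_le hc hx.le

theorem exp_neg_mul_mul_rpow_le {c p x : ℝ} (hc : 0 < c) (hp : 0 ≤ p) (hp2 : p ≤ 2)
    (hx : 0 ≤ x) : Real.exp (-c * x) * x ^ p ≤ 1 + 2 / c ^ 2 := by
  have hexp : Real.exp (-c * x) ≤ 1 := Real.exp_le_one_iff.2 (by nlinarith)
  calc Real.exp (-c * x) * x ^ p ≤ Real.exp (-c * x) * (1 + x ^ 2) := by
        gcongr; exact rpow_le_one_add_sq hp hp2 hx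
    _ = Real.exp (-c * x) + Real.exp (-c * x) * x ^ 2 := by ring
    _ ≤ 1 + 2 / c ^ 2 := add_le_add hexp (exp_neg_mul_mul_sq_le hc hx)

theorem exp_neg_mul_le_rpow_sub_two {a c x : ℝ} (hc : 0 < c) (ha : 0 ≤ a) (ha2 : a ≤ 2)
    (hx : 0 < x) : Real.exp (-c * x) ≤ (1 + 2 / c ^ 2) * x ^ (a - 2) := by
  have h := exp_neg_mul_mul_rpow_le (p := 2 - a) hc (by linarith) (by linarith) hx.le
  calc Real.exp (-c * x) = Real.exp (-c * x) * x ^ (2 - a) * x ^ (a - 2) := by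
        rw [mul_assoc, ← Real.rpow_add hx]; simp
    _ ≤ (1 + 2 / c ^ 2) * x ^ (a - 2) := by gcongr

theorem abs_rpow_sub_rpow_le {c x y q : ℝ} (hc : c ≤ 1) (hx : 0 < x) (hxy : x ≤ y) (hq : 0 ≤ q) :
    |(y + q) ^ c - y ^ c| ≤ |c| * x ^ (c - 1) * q := by
  have h := (convex_Ici x).norm_image_sub_le_of_norm_hasDerivWithin_le
    (f := fun z : ℝ => z ^ c) (f' := fun z => c * z ^ (c - 1)) (C := |c| * x ^ (c - 1))
    (fun z hz => (Real.hasDerivAt_rpow_const (Or.inl (hx.trans_le hz).ne')).hasDerivWithinAt)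
    (fun z (hz : x ≤ z) => by
      rw [norm_mul, Real.norm_eq_abs, Real.norm_of_nonneg (Real.rpow_nonneg (hx.le.trans hz) _)]
      gcongr ?_ * ?_
      exact Real.rpow_le_rpow_of_nonpos hx hz (by linarith))
    hxy (show x ≤ y + q by linarith)
  simpa [abs_of_nonneg hq] using h

theorem abs_rpow_second_difference_le {a x p q : ℝ} (ha : 0 ≤ a) (ha2 : a ≤ 2) (hx : 0 < x)
    (hp : 0 ≤ p) (hq : 0 ≤ q) :
    |((x + p + q) ^ a - (x + p) ^ a) - ((x + q) ^ a - x ^ a)| ≤ 2 * x ^ (a - 2) * (p * q) := by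
  have hcoeff : |a| * |a - 1| ≤ 2 * 1 :=
    mul_le_mul (abs_le.2 ⟨by linarith, ha2⟩) (abs_le.2 ⟨by linarith, by linarith⟩)
      (abs_nonneg _) zero_le_two
  have h := (convex_Ici x).norm_image_sub_le_of_norm_hasDerivWithin_le
    (f := fun z : ℝ => (z + q) ^ a - z ^ a)
    (f' := fun z => a * (z + q) ^ (a - 1) - a * z ^ (a - 1))
    (C := |a| * (|a - 1| * x ^ (a - 2) * q))
    (fun z (hz : x ≤ z) => by
      have hz' : 0 < z := hx.trans_le hz
      have hd := ((hasDerivAt_id z).add_const q).rpow_const (p := a)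
        (Or.inl (show z + q ≠ 0 by positivity))
      simp only [id, one_mul] at hd
      exact (hd.sub (Real.hasDerivAt_rpow_const (Or.inl hz'.ne'))).hasDerivWithinAt)
    (fun z hz => by
      have hd := abs_rpow_sub_rpow_le (c := a - 1) (by linarith) hx hz hq
      rw [show a - 1 - 1 = a - 2 by ring] at hd
      rw [← mul_sub, norm_mul, Real.norm_eq_abs, Real.norm_eq_abs]
      gcongr)
    Set.self_mem_Ici (show x ≤ x + p by linarith)
  rw [Real.norm_eq_abs, add_sub_cancel_left, Real.norm_of_nonneg hp] at h
  calc _ ≤ |a| * (|a - 1| * x ^ (a - 2) * q) * p := h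
    _ = |a| * |a - 1| * (x ^ (a - 2) * (p * q)) := by ring
    _ ≤ 2 * 1 * (x ^ (a - 2) * (p * q)) := by gcongr
    _ = 2 * x ^ (a - 2) * (p * q) := by ring

theorem rpow_second_difference_nonpos {a x p q : ℝ} (ha : 0 ≤ a) (ha1 : a ≤ 1) (hx : 0 ≤ x)
    (hp : 0 ≤ p) (hq : 0 ≤ q) :
    ((x + p + q) ^ a - (x + p) ^ a) - ((x + q) ^ a - x ^ a) ≤ 0 := by
  rcases (add_nonneg hp hq).eq_or_lt with hpq | hpq
  · obtain ⟨rfl, rfl⟩ := (add_eq_zero_iff_of_nonneg hp hq).1 hpq.symm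
    simp
  · have hconc := (Real.concaveOn_rpow ha ha1).2 (show x ∈ Set.Ici 0 from hx)
      (show x + p + q ∈ Set.Ici 0 by simp only [Set.mem_Ici]; positivity)
    have hxp := hconc (div_nonneg hq hpq.le) (div_nonneg hp hpq.le) (by field_simp; ring)
    have hxq := hconc (div_nonneg hp hpq.le) (div_nonneg hq hpq.le) (by field_simp)
    simp only [smul_eq_mul] at hxp hxq
    rw [show q / (p + q) * x + p / (p + q) * (x + p + q) = x + p by field_simp; ring] at hxp
    rw [show p / (p + q) * x + q / (p + q) * (x + p + q) = x + q by field_simp; ring] at hxq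
    have hsum : p / (p + q) + q / (p + q) = 1 := by field_simp
    linear_combination hxp + hxq - (x ^ a + (x + p + q) ^ a) * hsum

theorem rpow_sub_rpow_le_of_le_two_mul {b m x y : ℝ} (hb : 0 ≤ b) (hb2 : b ≤ 2) (hm : 0 < m)
    (hx : m ≤ x) (hxy : x ≤ y) (hy : y ≤ 2 * m) :
    y ^ b - x ^ b ≤ 4 * m ^ (b - 1) * (y - x) := by
  have h := (convex_Icc m (2 * m)).norm_image_sub_le_of_norm_hasDerivWithin_le
    (f := fun z : ℝ => z ^ b) (f' := fun z => b * z ^ (b - 1)) (C := 4 * m ^ (b - 1))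
    (fun z hz => (Real.hasDerivAt_rpow_const (Or.inl (hm.trans_le hz.1).ne')).hasDerivWithinAt)
    (fun z hz => by
      have hz0 : 0 < z := hm.trans_le hz.1
      have hpow : z ^ (b - 1) ≤ 2 * m ^ (b - 1) :=
        calc z ^ (b - 1) = z ^ (b - 2) * z := by
              rw [← Real.rpow_add_one hz0.ne']; ring_nf
          _ ≤ m ^ (b - 2) * (2 * m) :=
              mul_le_mul (Real.rpow_le_rpow_of_nonpos hm hz.1 (by linarith)) hz.2 hz0.le
                (by positivity)
          _ = 2 * m ^ (b - 1) := by
              rw [mul_left_comm, ← Real.rpow_add_one hm.ne']; ring_nf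
      rw [Real.norm_of_nonneg (by positivity)]
      nlinarith [Real.rpow_nonneg hm.le (b - 1)])
    ⟨hx, hxy.trans hy⟩ ⟨hx.trans hxy, hy⟩
  rw [Real.norm_of_nonneg (sub_nonneg.2 hxy)] at h
  exact (le_abs_self _).trans h

end PowerFunction

section OUTransform

/-- The Wiener-type integral `∫_s^t e^{-θ (t - u)} df(u)`, with the integration by parts carried
out so that it makes sense for every continuous `f`. -/
noncomputable def ouTransform (θ s t : ℝ) (f : ℝ → ℝ) : ℝ :=
  f t - Real.exp (-θ * (t - s)) * f s - θ * ∫ u in s..t, Real.exp (-θ * (t - u)) * f u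

variable {θ s t M : ℝ} {f g : ℝ → ℝ}

theorem ouTransform_congr (hst : s ≤ t) (h : Set.EqOn f g (Set.Icc s t)) :
    ouTransform θ s t f = ouTransform θ s t g := by
  have hint : ∫ u in s..t, Real.exp (-θ * (t - u)) * f u
      = ∫ u in s..t, Real.exp (-θ * (t - u)) * g u :=
    intervalIntegral.integral_congr fun u hu => by
      simp only [h (Set.uIcc_of_le hst ▸ hu)]
  rw [ouTransform, hint, h (Set.left_mem_Icc.2 hst), h (Set.right_mem_Icc.2 hst), ouTransform]

theorem ouTransform_const_mul (c : ℝ) (f : ℝ → ℝ) :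
    ouTransform θ s t (fun u => c * f u) = c * ouTransform θ s t f := by
  simp only [ouTransform, mul_left_comm _ c, intervalIntegral.integral_const_mul]
  ring

theorem ouTransform_sub (hf : Continuous f) (hg : Continuous g) :
    ouTransform θ s t (fun u => f u - g u) = ouTransform θ s t f - ouTransform θ s t g := by
  simp only [ouTransform, mul_sub]
  rw [intervalIntegral.integral_sub (Continuous.intervalIntegrable (by fun_prop) _ _)
    (Continuous.intervalIntegrable (by fun_prop) _ _)]
  ring

theorem ouTransform_add (hf : Continuous f) (hg : Continuous g) :
    ouTransform θ s t (fun u => f u + g u) = ouTransform θ s t f + ouTransform θ s t g := by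
  have hsub := ouTransform_sub (θ := θ) (s := s) (t := t) hf (hg.const_mul (-1))
  rw [ouTransform_const_mul] at hsub
  simpa only [neg_one_mul, sub_neg_eq_add] using hsub

theorem ouTransform_split (hf : Continuous f) (m : ℝ) :
    ouTransform θ s t f
      = Real.exp (-θ * (t - m)) * ouTransform θ s m f + ouTransform θ m t f := by
  have hexp : ∀ u, Real.exp (-θ * (t - u)) = Real.exp (-θ * (t - m)) * Real.exp (-θ * (m - u)) :=
    fun u => by rw [← Real.exp_add]; ring_nf
  have hint : ∫ u in s..m, Real.exp (-θ * (t - u)) * f u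
      = Real.exp (-θ * (t - m)) * ∫ u in s..m, Real.exp (-θ * (m - u)) * f u := by
    simp only [← intervalIntegral.integral_const_mul, ← mul_assoc, ← hexp]
  simp only [ouTransform]
  rw [← intervalIntegral.integral_add_adjacent_intervals (b := m)
    (Continuous.intervalIntegrable (by fun_prop) _ _)
    (Continuous.intervalIntegrable (by fun_prop) _ _), hint, hexp s]
  ring

theorem mul_integral_exp_neg_mul_sub :
    θ * ∫ u in s..t, Real.exp (-θ * (t - u)) = 1 - Real.exp (-θ * (t - s)) := by
  have hderiv : ∀ u ∈ Set.uIcc s t, HasDerivAt (fun u => Real.exp (-θ * (t - u)))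
      (θ * Real.exp (-θ * (t - u))) u := fun u _ =>
    (((hasDerivAt_id' u).const_sub t).const_mul (-θ)).exp.congr_deriv (by ring)
  rw [← intervalIntegral.integral_const_mul, intervalIntegral.integral_eq_sub_of_hasDerivAt hderiv
    (Continuous.intervalIntegrable (by fun_prop) _ _)]
  simp

theorem mul_integral_exp_mul_le (hθ : 0 ≤ θ) (hst : s ≤ t) (hf : Continuous f)
    (h : ∀ u ∈ Set.Icc s t, f u ≤ M) :
    θ * ∫ u in s..t, Real.exp (-θ * (t - u)) * f u ≤ (1 - Real.exp (-θ * (t - s))) * M := by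
  rw [← mul_integral_exp_neg_mul_sub, mul_assoc, ← intervalIntegral.integral_mul_const]
  gcongr θ * ?_
  refine intervalIntegral.integral_mono_on hst (Continuous.intervalIntegrable (by fun_prop) _ _)
    (Continuous.intervalIntegrable (by fun_prop) _ _) fun u hu => ?_
  gcongr
  exact h u hu

theorem ouTransform_nonneg (hθ : 0 ≤ θ) (hst : s ≤ t) (hf : Continuous f)
    (h : ∀ u ∈ Set.Icc s t, f u ≤ f t) : 0 ≤ ouTransform θ s t f := by
  have hint := mul_integral_exp_mul_le hθ hst hf h
  have hstart : Real.exp (-θ * (t - s)) * f s ≤ Real.exp (-θ * (t - s)) * f t := by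
    gcongr
    exact h s (Set.left_mem_Icc.2 hst)
  simp only [ouTransform]
  linarith

theorem ouTransform_id_le (hθ : 0 < θ) : ouTransform θ s t (fun u => u) ≤ 1 / θ := by
  have hderiv : ∀ u ∈ Set.uIcc s t, HasDerivAt (fun u => Real.exp (-θ * (t - u)) * (u - 1 / θ))
      (θ * (Real.exp (-θ * (t - u)) * u)) u := fun u _ =>
    ((((hasDerivAt_id' u).const_sub t).const_mul (-θ)).exp.mul
      ((hasDerivAt_id' u).sub_const (1 / θ))).congr_deriv (by field_simp; ring)
  have hint := intervalIntegral.integral_eq_sub_of_hasDerivAt hderiv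
    (Continuous.intervalIntegrable (by fun_prop) _ _)
  rw [intervalIntegral.integral_const_mul] at hint
  have hpos : 0 ≤ Real.exp (-θ * (t - s)) * (1 / θ) := by positivity
  simp only [ouTransform, hint, sub_self, mul_zero, Real.exp_zero]
  linarith

theorem ouTransform_le_of_sub_le (hθ : 0 < θ) (hst : s ≤ t) (hM : 0 ≤ M) (hf : Continuous f)
    (h : ∀ u ∈ Set.Icc s t, f t - f u ≤ M * (t - u)) : ouTransform θ s t f ≤ M / θ := by
  have hnonneg : 0 ≤ ouTransform θ s t (fun u => M * u - f u) :=
    ouTransform_nonneg hθ.le hst (by fun_prop) fun u hu => by linarith [h u hu]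
  rw [ouTransform_sub (by fun_prop) hf, ouTransform_const_mul, sub_nonneg] at hnonneg
  calc ouTransform θ s t f ≤ M * ouTransform θ s t (fun u => u) := hnonneg
    _ ≤ M * (1 / θ) := by gcongr; exact ouTransform_id_le hθ
    _ = M / θ := mul_one_div M θ

theorem ouTransform_le_of_abs_le (hθ : 0 ≤ θ) (hst : s ≤ t) (hf : Continuous f)
    (h : ∀ u ∈ Set.Icc s t, |f u| ≤ M) : ouTransform θ s t f ≤ 2 * M := by
  have hint := mul_integral_exp_mul_le (f := fun u => -f u) hθ hst hf.neg
    fun u hu => (neg_le_abs _).trans (h u hu)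
  simp only [mul_neg, intervalIntegral.integral_neg] at hint
  have hstart : Real.exp (-θ * (t - s)) * -f s ≤ Real.exp (-θ * (t - s)) * M := by
    gcongr
    exact (neg_le_abs _).trans (h s (Set.left_mem_Icc.2 hst))
  have hend := (le_abs_self _).trans (h t (Set.right_mem_Icc.2 hst))
  simp only [ouTransform]
  linarith

theorem abs_ouTransform_le (hθ : 0 ≤ θ) (hst : s ≤ t) (hf : Continuous f)
    (h : ∀ u ∈ Set.Icc s t, |f u| ≤ M) : |ouTransform θ s t f| ≤ 2 * M := by
  refine abs_le'.2 ⟨ouTransform_le_of_abs_le hθ hst hf h, ?_⟩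
  have hneg := ouTransform_le_of_abs_le (f := fun u => -1 * f u) hθ hst (by fun_prop)
    (by simpa using h)
  rwa [ouTransform_const_mul, neg_one_mul] at hneg

end OUTransform

section OUTransform₂

/-- The double integral `∫_s^t ∫_{s'}^{t'} e^{-θ (t - u)} e^{-θ (t' - v)} d²h(u, v)`, with both
integrations by parts carried out. Applied to the covariance of a process, it is the covariance of
two integrals against that process. -/
noncomputable def ouTransform₂ (θ s t s' t' : ℝ) (h : ℝ → ℝ → ℝ) : ℝ :=
  ouTransform θ s t fun u => ouTransform θ s' t' (h u)

/-- The increment of `h` over the rectangle `[u₁, u₂] × [v₁, v₂]`. -/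
def rectIncrement (h : ℝ → ℝ → ℝ) (u₁ u₂ v₁ v₂ : ℝ) : ℝ :=
  (h u₂ v₂ - h u₁ v₂) - (h u₂ v₁ - h u₁ v₁)

variable {θ s t s' t' M : ℝ} {h k : ℝ → ℝ → ℝ}

theorem ouTransform₂_congr (hst : s ≤ t) (hst' : s' ≤ t')
    (hhk : ∀ u ∈ Set.Icc s t, ∀ v ∈ Set.Icc s' t', h u v = k u v) :
    ouTransform₂ θ s t s' t' h = ouTransform₂ θ s t s' t' k :=
  ouTransform_congr hst fun u hu => ouTransform_congr hst' (hhk u hu)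

theorem ouTransform₂_const_mul (c : ℝ) (h : ℝ → ℝ → ℝ) :
    ouTransform₂ θ s t s' t' (fun u v => c * h u v) = c * ouTransform₂ θ s t s' t' h := by
  simp only [ouTransform₂, ouTransform_const_mul]

theorem continuous_ouTransform_apply (hh : Continuous (Function.uncurry h)) :
    Continuous fun u => ouTransform θ s t (h u) := by
  have hint : Continuous fun u => ∫ v in s..t, Real.exp (-θ * (t - v)) * h u v :=
    intervalIntegral.continuous_parametric_intervalIntegral_of_continuous'
      (f := fun u v => Real.exp (-θ * (t - v)) * h u v)
      ((by fun_prop : Continuous fun p : ℝ × ℝ => Real.exp (-θ * (t - p.2))).mul hh) s t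
  have hslice : ∀ v, Continuous fun u => h u v := fun v => hh.uncurry_right v
  have := hslice t
  have := hslice s
  simp only [ouTransform]
  fun_prop

theorem ouTransform₂_sub (hh : Continuous (Function.uncurry h))
    (hk : Continuous (Function.uncurry k)) :
    ouTransform₂ θ s t s' t' (fun u v => h u v - k u v)
      = ouTransform₂ θ s t s' t' h - ouTransform₂ θ s t s' t' k := by
  simp only [ouTransform₂]
  rw [← ouTransform_sub (continuous_ouTransform_apply hh) (continuous_ouTransform_apply hk)]
  congr 1 with u
  exact ouTransform_sub (hh.uncurry_left u) (hk.uncurry_left u)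

theorem ouTransform₂_split_left (hh : Continuous (Function.uncurry h)) (m : ℝ) :
    ouTransform₂ θ s t s' t' h
      = Real.exp (-θ * (t - m)) * ouTransform₂ θ s m s' t' h + ouTransform₂ θ m t s' t' h :=
  ouTransform_split (continuous_ouTransform_apply hh) m

theorem ouTransform₂_split_right (hh : Continuous (Function.uncurry h)) (m : ℝ) :
    ouTransform₂ θ s t s' t' h
      = Real.exp (-θ * (t' - m)) * ouTransform₂ θ s t s' m h + ouTransform₂ θ s t m t' h := by
  simp only [ouTransform₂]
  rw [← ouTransform_const_mul, ← ouTransform_add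
    ((continuous_ouTransform_apply hh).const_mul _) (continuous_ouTransform_apply hh)]
  congr 1 with u
  exact ouTransform_split (hh.uncurry_left u) m

theorem abs_ouTransform₂_le (hθ : 0 ≤ θ) (hst : s ≤ t) (hst' : s' ≤ t')
    (hh : Continuous (Function.uncurry h))
    (H : ∀ u ∈ Set.Icc s t, ∀ v ∈ Set.Icc s' t', |h u v| ≤ M) :
    |ouTransform₂ θ s t s' t' h| ≤ 4 * M := by
  calc |ouTransform₂ θ s t s' t' h| ≤ 2 * (2 * M) :=
        abs_ouTransform_le hθ hst (continuous_ouTransform_apply hh) fun u hu =>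
          abs_ouTransform_le hθ hst' (hh.uncurry_left u) (H u hu)
    _ = 4 * M := by ring

theorem ouTransform₂_le_of_rectIncrement_le (hθ : 0 < θ) (hst : s ≤ t) (hst' : s' ≤ t')
    (hM : 0 ≤ M) (hh : Continuous (Function.uncurry h))
    (H : ∀ u ∈ Set.Icc s t, ∀ v ∈ Set.Icc s' t',
      rectIncrement h u t v t' ≤ M * ((t - u) * (t' - v))) :
    ouTransform₂ θ s t s' t' h ≤ M / θ ^ 2 := by
  have houter : ∀ u ∈ Set.Icc s t,
      ouTransform θ s' t' (h t) - ouTransform θ s' t' (h u) ≤ M / θ * (t - u) := fun u hu => by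
    rw [← ouTransform_sub (hh.uncurry_left t) (hh.uncurry_left u), div_mul_eq_mul_div]
    refine ouTransform_le_of_sub_le hθ hst' (mul_nonneg hM (sub_nonneg.2 hu.2))
      ((hh.uncurry_left t).sub (hh.uncurry_left u)) fun v hv => ?_
    simpa only [mul_assoc, rectIncrement] using H u hu v hv
  calc ouTransform₂ θ s t s' t' h ≤ M / θ / θ :=
        ouTransform_le_of_sub_le hθ hst (by positivity) (continuous_ouTransform_apply hh) houter
    _ = M / θ ^ 2 := by rw [div_div, sq]

theorem abs_ouTransform₂_le_of_abs_rectIncrement_le (hθ : 0 < θ) (hst : s ≤ t) (hst' : s' ≤ t')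
    (hM : 0 ≤ M) (hh : Continuous (Function.uncurry h))
    (H : ∀ u ∈ Set.Icc s t, ∀ v ∈ Set.Icc s' t',
      |rectIncrement h u t v t'| ≤ M * ((t - u) * (t' - v))) :
    |ouTransform₂ θ s t s' t' h| ≤ M / θ ^ 2 := by
  have hneg := ouTransform₂_le_of_rectIncrement_le (h := fun u v => -1 * h u v) hθ hst hst' hM
    (hh.const_mul (-1)) fun u hu v hv => by
      refine Eq.trans_le ?_ ((neg_le_abs _).trans (H u hu v hv))
      simp only [rectIncrement]
      ring
  rw [ouTransform₂_const_mul, neg_one_mul] at hneg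
  exact abs_le'.2 ⟨ouTransform₂_le_of_rectIncrement_le hθ hst hst' hM hh fun u hu v hv =>
    (le_abs_self _).trans (H u hu v hv), hneg⟩

end OUTransform₂

section PowerKernels

variable {a b K m t u₁ u₂ v₁ v₂ : ℝ}

theorem continuous_add_rpow_rpow (hb : 0 ≤ b) (hK : 0 ≤ K) :
    Continuous (Function.uncurry fun u v : ℝ => (u ^ b + v ^ b) ^ K) :=
  ((continuous_fst.rpow_const fun _ => Or.inr hb).add
    (continuous_snd.rpow_const fun _ => Or.inr hb)).rpow_const fun _ => Or.inr hK

theorem continuous_abs_sub_rpow (ha : 0 ≤ a) :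
    Continuous (Function.uncurry fun u v : ℝ => |u - v| ^ a) :=
  (continuous_fst.sub continuous_snd).abs.rpow_const fun _ => Or.inr ha

theorem rectIncrement_add_rpow_rpow :
    rectIncrement (fun u v => (u ^ b + v ^ b) ^ K) u₁ u₂ v₁ v₂
      = ((u₁ ^ b + v₁ ^ b + (u₂ ^ b - u₁ ^ b) + (v₂ ^ b - v₁ ^ b)) ^ K
          - (u₁ ^ b + v₁ ^ b + (u₂ ^ b - u₁ ^ b)) ^ K)
        - ((u₁ ^ b + v₁ ^ b + (v₂ ^ b - v₁ ^ b)) ^ K - (u₁ ^ b + v₁ ^ b) ^ K) := by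
  simp only [rectIncrement]
  ring_nf

theorem rectIncrement_add_rpow_rpow_nonpos (hb : 0 ≤ b) (hK : 0 ≤ K) (hK1 : K ≤ 1)
    (hu₁ : 0 ≤ u₁) (hu : u₁ ≤ u₂) (hv₁ : 0 ≤ v₁) (hv : v₁ ≤ v₂) :
    rectIncrement (fun u v => (u ^ b + v ^ b) ^ K) u₁ u₂ v₁ v₂ ≤ 0 := by
  rw [rectIncrement_add_rpow_rpow]
  exact rpow_second_difference_nonpos hK hK1 (by positivity)
    (sub_nonneg.2 (Real.rpow_le_rpow hu₁ hu hb)) (sub_nonneg.2 (Real.rpow_le_rpow hv₁ hv hb))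

theorem abs_rectIncrement_add_rpow_rpow_le (hb : 0 ≤ b) (hb2 : b ≤ 2) (hK : 0 ≤ K) (hK2 : K ≤ 2)
    (hm : 0 < m) (hu₁ : m ≤ u₁) (hu : u₁ ≤ u₂) (hu₂ : u₂ ≤ 2 * m)
    (hv₁ : m ≤ v₁) (hv : v₁ ≤ v₂) (hv₂ : v₂ ≤ 2 * m) :
    |rectIncrement (fun u v => (u ^ b + v ^ b) ^ K) u₁ u₂ v₁ v₂|
      ≤ 32 * m ^ (b * K - 2) * ((u₂ - u₁) * (v₂ - v₁)) := by
  have hpow_u : 0 ≤ u₂ ^ b - u₁ ^ b :=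
    sub_nonneg.2 (Real.rpow_le_rpow (hm.le.trans hu₁) hu hb)
  have hpow_v : 0 ≤ v₂ ^ b - v₁ ^ b :=
    sub_nonneg.2 (Real.rpow_le_rpow (hm.le.trans hv₁) hv hb)
  have hbase : m ^ b ≤ u₁ ^ b + v₁ ^ b :=
    (Real.rpow_le_rpow hm.le hu₁ hb).trans
      (le_add_of_nonneg_right (Real.rpow_nonneg (hm.le.trans hv₁) b))
  have hbase_pos : 0 < u₁ ^ b + v₁ ^ b := (Real.rpow_pos_of_pos hm b).trans_le hbase
  have hexp : (m ^ b) ^ (K - 2) * (m ^ (b - 1) * m ^ (b - 1)) = m ^ (b * K - 2) := by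
    rw [← Real.rpow_mul hm.le, ← Real.rpow_add hm, ← Real.rpow_add hm]
    ring_nf
  rw [rectIncrement_add_rpow_rpow]
  calc _ ≤ 2 * (u₁ ^ b + v₁ ^ b) ^ (K - 2) * ((u₂ ^ b - u₁ ^ b) * (v₂ ^ b - v₁ ^ b)) :=
        abs_rpow_second_difference_le hK hK2 hbase_pos hpow_u hpow_v
    _ ≤ 2 * (m ^ b) ^ (K - 2)
          * ((4 * m ^ (b - 1) * (u₂ - u₁)) * (4 * m ^ (b - 1) * (v₂ - v₁))) := by
        gcongr 2 * ?_ * (?_ * ?_)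
        · exact Real.rpow_le_rpow_of_nonpos (by positivity) hbase (by linarith)
        · exact rpow_sub_rpow_le_of_le_two_mul hb hb2 hm hu₁ hu hu₂
        · exact rpow_sub_rpow_le_of_le_two_mul hb hb2 hm hv₁ hv hv₂
    _ = 32 * m ^ (b * K - 2) * ((u₂ - u₁) * (v₂ - v₁)) := by
        rw [← hexp]; ring

theorem abs_rectIncrement_abs_sub_rpow_le {δ : ℝ} (ha : 0 ≤ a) (ha2 : a ≤ 2) (hδ : 0 < δ)
    (hu : u₁ ≤ u₂) (hv : v₁ ≤ v₂) (hgap : δ ≤ u₁ - v₂) :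
    |rectIncrement (fun u v => |u - v| ^ a) u₁ u₂ v₁ v₂|
      ≤ 2 * δ ^ (a - 2) * ((u₂ - u₁) * (v₂ - v₁)) := by
  have hdiff := abs_rpow_second_difference_le ha ha2 (hδ.trans_le hgap) (sub_nonneg.2 hu)
    (sub_nonneg.2 hv)
  have hrect : rectIncrement (fun u v => |u - v| ^ a) u₁ u₂ v₁ v₂
      = -(((u₁ - v₂ + (u₂ - u₁) + (v₂ - v₁)) ^ a - (u₁ - v₂ + (u₂ - u₁)) ^ a)
        - ((u₁ - v₂ + (v₂ - v₁)) ^ a - (u₁ - v₂) ^ a)) := by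
    simp only [rectIncrement]
    rw [abs_of_nonneg (show 0 ≤ u₂ - v₂ by linarith), abs_of_nonneg (show 0 ≤ u₁ - v₂ by linarith),
      abs_of_nonneg (show 0 ≤ u₂ - v₁ by linarith), abs_of_nonneg (show 0 ≤ u₁ - v₁ by linarith)]
    ring_nf
  rw [hrect, abs_neg]
  refine hdiff.trans ?_
  have := mul_nonneg (sub_nonneg.2 hu) (sub_nonneg.2 hv)
  gcongr 2 * ?_ * _
  exact Real.rpow_le_rpow_of_nonpos hδ hgap (by linarith)

theorem abs_add_rpow_rpow_le {u v : ℝ} (hb : 0 ≤ b) (hK : 0 ≤ K) (hK1 : K ≤ 1)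
    (hu : u ∈ Set.Icc 0 t) (hv : v ∈ Set.Icc 0 t) :
    |(u ^ b + v ^ b) ^ K| ≤ 2 * t ^ (b * K) := by
  have hu0 := Real.rpow_nonneg hu.1 b
  have hv0 := Real.rpow_nonneg hv.1 b
  have ht := hu.1.trans hu.2
  rw [abs_of_nonneg (by positivity)]
  calc (u ^ b + v ^ b) ^ K ≤ (t ^ b + t ^ b) ^ K :=
        Real.rpow_le_rpow (by positivity) (add_le_add (Real.rpow_le_rpow hu.1 hu.2 hb)
          (Real.rpow_le_rpow hv.1 hv.2 hb)) hK
    _ = 2 ^ K * t ^ (b * K) := by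
        rw [← two_mul, Real.mul_rpow zero_le_two (by positivity), Real.rpow_mul ht]
    _ ≤ 2 * t ^ (b * K) := by
        gcongr
        exact Real.rpow_le_self_of_one_le one_le_two hK1

variable {θ s s' t' : ℝ}

theorem ouTransform₂_add_rpow_rpow_nonpos (hθ : 0 < θ) (hb : 0 ≤ b) (hK : 0 ≤ K) (hK1 : K ≤ 1)
    (hs : 0 ≤ s) (hst : s ≤ t) (hs' : 0 ≤ s') (hst' : s' ≤ t') :
    ouTransform₂ θ s t s' t' (fun u v => (u ^ b + v ^ b) ^ K) ≤ 0 := by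
  simpa only [zero_div] using ouTransform₂_le_of_rectIncrement_le hθ hst hst' le_rfl
    (continuous_add_rpow_rpow hb hK) fun u hu v hv => by
      rw [zero_mul]
      exact rectIncrement_add_rpow_rpow_nonpos hb hK hK1 (hs.trans hu.1) hu.2 (hs'.trans hv.1) hv.2

/- Splitting both variables at `t / 2`, the pieces that reach below `t / 2` carry a factor
`e^{-θ t / 2}`, and on the remaining square the kernel is smooth. -/
theorem abs_ouTransform₂_add_rpow_rpow_le (hθ : 0 < θ) (hb : 0 ≤ b) (hb2 : b ≤ 2) (hK : 0 ≤ K)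
    (hK1 : K ≤ 1) (ht : 0 < t) :
    |ouTransform₂ θ 0 t 0 t (fun u v => (u ^ b + v ^ b) ^ K)|
      ≤ 256 / θ ^ 2 * t ^ (b * K - 2) := by
  set A : ℝ → ℝ → ℝ := fun u v => (u ^ b + v ^ b) ^ K
  have hcont : Continuous (Function.uncurry A) := continuous_add_rpow_rpow hb hK
  have hm : 0 < t / 2 := half_pos ht
  have hmt : t / 2 ≤ t := half_le_self ht.le
  have hbound : ∀ u ∈ Set.Icc 0 t, ∀ v ∈ Set.Icc 0 t, |A u v| ≤ 2 * t ^ (b * K) :=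
    fun u hu v hv => abs_add_rpow_rpow_le hb hK hK1 hu hv
  have hlow : |ouTransform₂ θ 0 (t / 2) 0 t A| ≤ 4 * (2 * t ^ (b * K)) :=
    abs_ouTransform₂_le hθ.le hm.le ht.le hcont fun u hu v hv =>
      hbound u ⟨hu.1, hu.2.trans hmt⟩ v hv
  have hmixed : |ouTransform₂ θ (t / 2) t 0 (t / 2) A| ≤ 4 * (2 * t ^ (b * K)) :=
    abs_ouTransform₂_le hθ.le hmt hm.le hcont fun u hu v hv =>
      hbound u ⟨hm.le.trans hu.1, hu.2⟩ v ⟨hv.1, hv.2.trans hmt⟩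
  have hhigh : |ouTransform₂ θ (t / 2) t (t / 2) t A| ≤ 32 * (t / 2) ^ (b * K - 2) / θ ^ 2 :=
    abs_ouTransform₂_le_of_abs_rectIncrement_le hθ hmt hmt (by positivity) hcont
      fun u hu v hv => abs_rectIncrement_add_rpow_rpow_le hb hb2 hK (by linarith) hm
        hu.1 hu.2 (by linarith) hv.1 hv.2 (by linarith)
  have hexp := exp_neg_mul_mul_rpow_le_rpow_sub_two (b * K) (half_pos hθ) ht
  have hhalf := half_rpow_sub_two_le (mul_nonneg hb hK) ht.le
  rw [ouTransform₂_split_left hcont (t / 2), ouTransform₂_split_right hcont (t / 2) (s := t / 2),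
    show -θ * (t - t / 2) = -(θ / 2) * t by ring]
  calc _ ≤ Real.exp (-(θ / 2) * t) * (4 * (2 * t ^ (b * K)))
        + (Real.exp (-(θ / 2) * t) * (4 * (2 * t ^ (b * K)))
          + 32 * (t / 2) ^ (b * K - 2) / θ ^ 2) := by
        refine (abs_add_le _ _).trans (add_le_add ?_ ((abs_add_le _ _).trans
          (add_le_add ?_ hhigh))) <;> rw [abs_mul, Real.abs_exp] <;> gcongr
    _ = 16 * (Real.exp (-(θ / 2) * t) * t ^ (b * K))
        + 32 / θ ^ 2 * (t / 2) ^ (b * K - 2) := by ring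
    _ ≤ 16 * (2 / (θ / 2) ^ 2 * t ^ (b * K - 2))
        + 32 / θ ^ 2 * (4 * t ^ (b * K - 2)) := by gcongr
    _ = 256 / θ ^ 2 * t ^ (b * K - 2) := by field_simp; ring

theorem abs_ouTransform₂_abs_sub_rpow_le {δ : ℝ} (hθ : 0 < θ) (ha : 0 ≤ a) (ha2 : a ≤ 2)
    (hδ : 0 < δ) (hst : s ≤ t) (hst' : s' ≤ t') (hgap : δ ≤ s - t') :
    |ouTransform₂ θ s t s' t' (fun u v => |u - v| ^ a)| ≤ 2 / θ ^ 2 * δ ^ (a - 2) := by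
  rw [div_mul_eq_mul_div]
  exact abs_ouTransform₂_le_of_abs_rectIncrement_le hθ hst hst' (by positivity)
    (continuous_abs_sub_rpow ha) fun u hu v hv =>
      abs_rectIncrement_abs_sub_rpow_le ha ha2 hδ hu.2 hv.2 (by linarith [hu.1])

end PowerKernels

section StationaryKernel

/-- The integral `∫_0^t e^{-θ (t - v)} γ |u - v| dv` for `u ∈ [0, t]`, with `z = |u - v|` taken as
the integration variable on either side of `u`. -/
noncomputable def expPotential (θ t : ℝ) (γ : ℝ → ℝ) (u : ℝ) : ℝ :=
  Real.exp (-θ * (t - u)) *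
    ((∫ z in (0 : ℝ)..u, Real.exp (-θ * z) * γ z) + ∫ z in (0 : ℝ)..(t - u), Real.exp (θ * z) * γ z)

variable {θ t : ℝ} {γ : ℝ → ℝ}

theorem integral_exp_mul_comp_sub_left (θ t : ℝ) (γ : ℝ → ℝ) :
    ∫ u in (0 : ℝ)..t, Real.exp (-θ * (t - u)) * γ (t - u)
      = ∫ z in (0 : ℝ)..t, Real.exp (-θ * z) * γ z := by
  simpa using intervalIntegral.integral_comp_sub_left (a := 0) (b := t)
    (fun z => Real.exp (-θ * z) * γ z) t

theorem integral_exp_mul_comp_abs_sub {u : ℝ} (hγ : Continuous γ) (hu : u ∈ Set.Icc 0 t) :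
    ∫ v in (0 : ℝ)..t, Real.exp (-θ * (t - v)) * γ |u - v| = expPotential θ t γ u := by
  have hexp : ∀ v, Real.exp (-θ * (t - v)) = Real.exp (-θ * (t - u)) * Real.exp (-θ * (u - v)) :=
    fun v => by rw [← Real.exp_add]; ring_nf
  have hleft : ∫ v in (0 : ℝ)..u, Real.exp (-θ * (t - v)) * γ |u - v|
      = Real.exp (-θ * (t - u)) * ∫ z in (0 : ℝ)..u, Real.exp (-θ * z) * γ z := by
    rw [← integral_exp_mul_comp_sub_left, ← intervalIntegral.integral_const_mul]
    refine intervalIntegral.integral_congr fun v hv => ?_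
    rw [Set.uIcc_of_le hu.1] at hv
    simp only [abs_of_nonneg (sub_nonneg.2 hv.2), hexp v, mul_assoc]
  have hright : ∫ v in u..t, Real.exp (-θ * (t - v)) * γ |u - v|
      = Real.exp (-θ * (t - u)) * ∫ z in (0 : ℝ)..(t - u), Real.exp (θ * z) * γ z := by
    have hsubst := intervalIntegral.integral_comp_sub_right (a := u) (b := t)
      (fun z => Real.exp (θ * z) * γ z) u
    rw [sub_self] at hsubst
    rw [← hsubst, ← intervalIntegral.integral_const_mul]
    refine intervalIntegral.integral_congr fun v hv => ?_
    rw [Set.uIcc_of_le hu.2] at hv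
    simp only [abs_sub_comm u v, abs_of_nonneg (sub_nonneg.2 hv.1), hexp v, mul_assoc]
    ring_nf
  rw [← intervalIntegral.integral_add_adjacent_intervals (b := u)
    (Continuous.intervalIntegrable (by fun_prop) _ _)
    (Continuous.intervalIntegrable (by fun_prop) _ _), hleft, hright, expPotential, mul_add]

theorem hasDerivAt_expPotential (hγ : Continuous γ) (u : ℝ) :
    HasDerivAt (expPotential θ t γ)
      (θ * expPotential θ t γ u + Real.exp (-θ * t) * γ u - γ (t - u)) u := by
  have hleft : HasDerivAt (fun u => ∫ z in (0 : ℝ)..u, Real.exp (-θ * z) * γ z)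
      (Real.exp (-θ * u) * γ u) u :=
    ((by fun_prop : Continuous fun z => Real.exp (-θ * z) * γ z).integral_hasStrictDerivAt
      0 u).hasDerivAt
  have hright : HasDerivAt (fun u => ∫ z in (0 : ℝ)..(t - u), Real.exp (θ * z) * γ z)
      (Real.exp (θ * (t - u)) * γ (t - u) * -1) u :=
    ((by fun_prop : Continuous fun z => Real.exp (θ * z) * γ z).integral_hasStrictDerivAt
      0 (t - u)).hasDerivAt.comp u ((hasDerivAt_id' u).const_sub t)
  have hexp_left : Real.exp (-θ * (t - u)) * Real.exp (-θ * u) = Real.exp (-θ * t) := by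
    rw [← Real.exp_add]; ring_nf
  have hexp_right : Real.exp (-θ * (t - u)) * Real.exp (θ * (t - u)) = 1 := by
    rw [← Real.exp_add]; simp
  refine ((((hasDerivAt_id' u).const_sub t).const_mul (-θ)).exp.mul
    (hleft.add hright)).congr_deriv ?_
  simp only [expPotential, Pi.add_apply]
  linear_combination γ u * hexp_left - γ (t - u) * hexp_right

theorem continuous_expPotential (hγ : Continuous γ) : Continuous (expPotential θ t γ) :=
  continuous_iff_continuousAt.2 fun u => (hasDerivAt_expPotential hγ u).continuousAt

theorem expPotential_zero :
    expPotential θ t γ 0 = ∫ u in (0 : ℝ)..t, Real.exp (-θ * (t - u)) * γ u := by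
  simp only [expPotential, sub_zero, intervalIntegral.integral_same, zero_add,
    ← intervalIntegral.integral_const_mul, ← mul_assoc, ← Real.exp_add]
  ring_nf

theorem expPotential_self :
    expPotential θ t γ t = ∫ z in (0 : ℝ)..t, Real.exp (-θ * z) * γ z := by
  simp [expPotential]

theorem ouTransform_expPotential (hγ : Continuous γ) :
    ouTransform θ 0 t (expPotential θ t γ) = 0 := by
  have hD : Continuous (expPotential θ t γ) := continuous_expPotential hγ
  have hderiv : ∀ u ∈ Set.uIcc 0 t, HasDerivAt
      (fun u => Real.exp (-θ * (t - u)) * expPotential θ t γ u)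
      (2 * θ * (Real.exp (-θ * (t - u)) * expPotential θ t γ u)
        + Real.exp (-θ * t) * (Real.exp (-θ * (t - u)) * γ u)
        - Real.exp (-θ * (t - u)) * γ (t - u)) u := fun u _ =>
    ((((hasDerivAt_id' u).const_sub t).const_mul (-θ)).exp.mul
      (hasDerivAt_expPotential hγ u)).congr_deriv (by ring)
  have hint := intervalIntegral.integral_eq_sub_of_hasDerivAt hderiv
    (Continuous.intervalIntegrable (by fun_prop) _ _)
  rw [intervalIntegral.integral_sub (Continuous.intervalIntegrable (by fun_prop) _ _)
    (Continuous.intervalIntegrable (by fun_prop) _ _), intervalIntegral.integral_add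
    (Continuous.intervalIntegrable (by fun_prop) _ _)
    (Continuous.intervalIntegrable (by fun_prop) _ _), intervalIntegral.integral_const_mul,
    intervalIntegral.integral_const_mul, integral_exp_mul_comp_sub_left,
    ← expPotential_zero (γ := γ), ← expPotential_self, sub_self, mul_zero, Real.exp_zero] at hint
  simp only [ouTransform, sub_zero] at hint ⊢
  linear_combination -hint / 2

theorem ouTransform₂_comp_abs_sub (hγ : Continuous γ) (ht : 0 ≤ t) :
    ouTransform₂ θ 0 t 0 t (fun u v => γ |u - v|)
      = γ 0 * (1 + Real.exp (-θ * t) ^ 2)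
        - θ * (∫ z in (0 : ℝ)..t, Real.exp (-θ * z) * γ z)
        - Real.exp (-θ * t) *
          (2 * γ t - θ * ∫ u in (0 : ℝ)..t, Real.exp (-θ * (t - u)) * γ u) := by
  have hinner : ∀ u ∈ Set.Icc 0 t, ouTransform θ 0 t (fun v => γ |u - v|)
      = γ (t - u) - Real.exp (-θ * t) * γ u - θ * expPotential θ t γ u := fun u hu => by
    rw [ouTransform, integral_exp_mul_comp_abs_sub hγ hu, abs_sub_comm u t, sub_zero, sub_zero,
      abs_of_nonneg (sub_nonneg.2 hu.2), abs_of_nonneg hu.1]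
  have hD : Continuous (expPotential θ t γ) := continuous_expPotential hγ
  rw [ouTransform₂, ouTransform_congr ht hinner, ouTransform_sub (by fun_prop) (by fun_prop),
    ouTransform_sub (by fun_prop) (by fun_prop), ouTransform_const_mul, ouTransform_const_mul,
    ouTransform_expPotential hγ]
  simp only [ouTransform, integral_exp_mul_comp_sub_left, sub_self, sub_zero]
  ring

end StationaryKernel

section Gamma

variable {a θ t : ℝ}

theorem integrableOn_exp_neg_mul_mul_rpow (ha : -1 < a) (hθ : 0 < θ) :
    IntegrableOn (fun z : ℝ => Real.exp (-θ * z) * z ^ a) (Set.Ioi 0) := by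
  simpa only [Real.rpow_one, mul_comm] using
    integrableOn_rpow_mul_exp_neg_mul_rpow (p := 1) ha one_pos hθ

theorem mul_integral_exp_neg_mul_mul_rpow (ha : -1 < a) (hθ : 0 < θ) :
    θ * ∫ z in Set.Ioi (0 : ℝ), Real.exp (-θ * z) * z ^ a = Real.Gamma (a + 1) / θ ^ a := by
  have h := Real.integral_rpow_mul_exp_neg_mul_Ioi (a := a + 1) (by linarith) hθ
  simp only [add_sub_cancel_right, ← neg_mul, mul_comm _ (Real.exp _)] at h
  rw [h, one_div, Real.inv_rpow hθ.le, Real.rpow_add_one hθ.ne']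
  field_simp

theorem Gamma_add_one_div_rpow_le (ha : 0 ≤ a) (ha2 : a ≤ 2) (hθ : 0 < θ) :
    Real.Gamma (a + 1) / θ ^ a ≤ 1 + 2 / θ ^ 2 := by
  have hint := integrableOn_exp_neg_mul_mul_rpow (a := 2) (by norm_num) hθ
  have hint₀ := integrableOn_exp_neg_mul_mul_rpow (a := 0) (by norm_num) hθ
  have h₀ := mul_integral_exp_neg_mul_mul_rpow (a := 0) (by norm_num) hθ
  have h₂ := mul_integral_exp_neg_mul_mul_rpow (a := 2) (by norm_num) hθ
  have hGamma : Real.Gamma (2 + 1) = 2 := by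
    rw [Real.Gamma_add_one two_ne_zero, Real.Gamma_two, mul_one]
  rw [← mul_integral_exp_neg_mul_mul_rpow (by linarith) hθ]
  calc θ * ∫ z in Set.Ioi (0 : ℝ), Real.exp (-θ * z) * z ^ a
      ≤ θ * ∫ z in Set.Ioi (0 : ℝ),
          (Real.exp (-θ * z) * z ^ (0 : ℝ) + Real.exp (-θ * z) * z ^ (2 : ℝ)) := by
        gcongr θ * ?_
        refine setIntegral_mono_on (integrableOn_exp_neg_mul_mul_rpow (by linarith) hθ)
          (hint₀.add hint) measurableSet_Ioi fun z (hz : 0 < z) => ?_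
        rw [← mul_add, Real.rpow_zero, Real.rpow_two]
        gcongr
        exact rpow_le_one_add_sq ha ha2 hz.le
    _ = 1 + 2 / θ ^ 2 := by
        rw [integral_add hint₀ hint, mul_add, h₀, h₂, hGamma, Real.rpow_two]
        simp

theorem integral_Ioi_exp_neg_mul_mul_rpow_le (ha : 0 ≤ a) (ha2 : a ≤ 2) (hθ : 0 < θ)
    (ht : 0 < t) :
    θ * ∫ z in Set.Ioi t, Real.exp (-θ * z) * z ^ a ≤ 2 / θ ^ 2 * t ^ (a - 2) := by
  have hsubset : Set.Ioi t ⊆ Set.Ioi 0 := Set.Ioi_subset_Ioi ht.le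
  have hint := integrableOn_exp_neg_mul_mul_rpow (a := 2) (by norm_num) hθ
  have h₂ := mul_integral_exp_neg_mul_mul_rpow (a := 2) (by norm_num) hθ
  rw [Real.Gamma_add_one two_ne_zero, Real.Gamma_two, mul_one, Real.rpow_two] at h₂
  rw [← h₂, mul_assoc, mul_comm (∫ _ in _, _)]
  gcongr θ * ?_
  calc ∫ z in Set.Ioi t, Real.exp (-θ * z) * z ^ a
      ≤ ∫ z in Set.Ioi t, t ^ (a - 2) * (Real.exp (-θ * z) * z ^ (2 : ℝ)) := by
        refine setIntegral_mono_on
          ((integrableOn_exp_neg_mul_mul_rpow (by linarith) hθ).mono_set hsubset)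
          ((hint.mono_set hsubset).const_mul _) measurableSet_Ioi fun z (hz : t < z) => ?_
        rw [mul_left_comm, Real.rpow_two, rpow_eq_rpow_sub_two_mul_sq a (ht.trans hz)]
        gcongr ?_ * (?_ * ?_)
        exact Real.rpow_le_rpow_of_nonpos ht hz.le (by linarith)
    _ ≤ t ^ (a - 2) * ∫ z in Set.Ioi (0 : ℝ), Real.exp (-θ * z) * z ^ (2 : ℝ) := by
        rw [integral_const_mul]
        refine mul_le_mul_of_nonneg_left (setIntegral_mono_set hint ?_ hsubset.eventuallyLE)
          (by positivity)
        filter_upwards [ae_restrict_mem measurableSet_Ioi] with z (hz : 0 < z)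
        exact mul_nonneg (Real.exp_pos _).le (Real.rpow_nonneg hz.le _)

theorem mul_intervalIntegral_exp_neg_mul_mul_rpow_mem_Icc (ha : 0 ≤ a) (ha2 : a ≤ 2) (hθ : 0 < θ)
    (ht : 0 < t) :
    θ * (∫ z in (0 : ℝ)..t, Real.exp (-θ * z) * z ^ a) ∈
      Set.Icc (Real.Gamma (a + 1) / θ ^ a - 2 / θ ^ 2 * t ^ (a - 2))
        (Real.Gamma (a + 1) / θ ^ a) := by
  have hint := integrableOn_exp_neg_mul_mul_rpow (a := a) (by linarith) hθ
  have hsplit : (∫ z in (0 : ℝ)..t, Real.exp (-θ * z) * z ^ a)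
      + ∫ z in Set.Ioi t, Real.exp (-θ * z) * z ^ a
        = ∫ z in Set.Ioi (0 : ℝ), Real.exp (-θ * z) * z ^ a :=
    intervalIntegral.integral_interval_add_Ioi hint (hint.mono_set (Set.Ioi_subset_Ioi ht.le))
  have htail := integral_Ioi_exp_neg_mul_mul_rpow_le ha ha2 hθ ht
  have htail_nonneg : 0 ≤ θ * ∫ z in Set.Ioi t, Real.exp (-θ * z) * z ^ a :=
    mul_nonneg hθ.le (setIntegral_nonneg measurableSet_Ioi fun z (hz : t < z) =>
      mul_nonneg (Real.exp_pos _).le (Real.rpow_nonneg (ht.trans hz).le a))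
  rw [← mul_integral_exp_neg_mul_mul_rpow (by linarith) hθ, ← hsplit, mul_add]
  constructor <;> linarith

end Gamma

section StationaryVariance

variable {a θ t : ℝ}

theorem neg_ouTransform₂_abs_sub_rpow (ha : 0 < a) (ht : 0 ≤ t) :
    -ouTransform₂ θ 0 t 0 t (fun u v => |u - v| ^ a)
      = θ * (∫ z in (0 : ℝ)..t, Real.exp (-θ * z) * z ^ a)
        + Real.exp (-θ * t) *
          (2 * t ^ a - θ * ∫ u in (0 : ℝ)..t, Real.exp (-θ * (t - u)) * u ^ a) := by
  rw [ouTransform₂_comp_abs_sub (γ := fun z => z ^ a)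
    (Real.continuous_rpow_const ha.le) ht, Real.zero_rpow ha.ne']
  ring

theorem mul_integral_exp_mul_rpow_mem_Icc (hθ : 0 ≤ θ) (ha : 0 ≤ a) (ht : 0 ≤ t) :
    θ * (∫ u in (0 : ℝ)..t, Real.exp (-θ * (t - u)) * u ^ a) ∈ Set.Icc 0 (t ^ a) := by
  refine ⟨mul_nonneg hθ (intervalIntegral.integral_nonneg ht fun u hu =>
    mul_nonneg (Real.exp_pos _).le (Real.rpow_nonneg hu.1 a)), ?_⟩
  refine (mul_integral_exp_mul_le hθ ht (Real.continuous_rpow_const ha)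
    fun u hu => Real.rpow_le_rpow hu.1 hu.2 ha).trans ?_
  exact mul_le_of_le_one_left (Real.rpow_nonneg ht a) (sub_le_self _ (Real.exp_pos _).le)

theorem abs_neg_ouTransform₂_abs_sub_rpow_sub_le (hθ : 0 < θ) (ha : 0 < a) (ha2 : a ≤ 2)
    (ht : 0 < t) :
    |-ouTransform₂ θ 0 t 0 t (fun u v => |u - v| ^ a) - Real.Gamma (a + 1) / θ ^ a|
      ≤ 4 / θ ^ 2 * t ^ (a - 2) := by
  obtain ⟨hlower, hupper⟩ := mul_intervalIntegral_exp_neg_mul_mul_rpow_mem_Icc ha.le ha2 hθ ht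
  obtain ⟨hJ, hJt⟩ := mul_integral_exp_mul_rpow_mem_Icc hθ.le ha.le ht.le
  have hexp := exp_neg_mul_mul_rpow_le_rpow_sub_two a hθ ht
  have hboundary_nonneg := mul_nonneg (Real.exp_pos (-θ * t)).le
    (show 0 ≤ 2 * t ^ a - θ * ∫ u in (0 : ℝ)..t, Real.exp (-θ * (t - u)) * u ^ a by
      linarith [Real.rpow_nonneg ht.le a])
  have hboundary_le := mul_le_mul_of_nonneg_left (sub_le_self (2 * t ^ a) hJ)
    (Real.exp_pos (-θ * t)).le
  have hpow : 0 ≤ 2 / θ ^ 2 * t ^ (a - 2) := by positivity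
  rw [neg_ouTransform₂_abs_sub_rpow ha ht.le, abs_le,
    show 4 / θ ^ 2 * t ^ (a - 2) = 2 * (2 / θ ^ 2 * t ^ (a - 2)) by ring]
  constructor <;> linarith

theorem neg_ouTransform₂_abs_sub_rpow_le (hθ : 0 < θ) (ha : 0 < a) (ha2 : a ≤ 2) (ht : 0 < t) :
    -ouTransform₂ θ 0 t 0 t (fun u v => |u - v| ^ a) ≤ 3 * (1 + 2 / θ ^ 2) := by
  have hupper := (mul_intervalIntegral_exp_neg_mul_mul_rpow_mem_Icc ha.le ha2 hθ ht).2.trans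
    (Gamma_add_one_div_rpow_le ha.le ha2 hθ)
  have hJ := (mul_integral_exp_mul_rpow_mem_Icc hθ.le ha.le ht.le).1
  have hexp := exp_neg_mul_mul_rpow_le hθ ha.le ha2 ht.le
  have hboundary_le := mul_le_mul_of_nonneg_left (sub_le_self (2 * t ^ a) hJ)
    (Real.exp_pos (-θ * t)).le
  rw [neg_ouTransform₂_abs_sub_rpow ha ht.le]
  linarith

end StationaryVariance

section JointMeasurability

variable {ι Ω E : Type*} [MeasurableSpace ι] [MeasurableSpace Ω] [NormedAddCommGroup E]
  {P : Measure Ω} {Y : ι → Ω → E}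

theorem aestronglyMeasurable_comp_simpleFunc
    (hY : ∀ i, AEStronglyMeasurable (Y i) P) (φ : SimpleFunc ι ι) (ν : Measure ι) :
    AEStronglyMeasurable (fun p : ι × Ω => Y (φ p.1) p.2) (ν.prod P) := by
  have hsum : (fun p : ι × Ω => Y (φ p.1) p.2)
      = ∑ i ∈ φ.range, (Prod.fst ⁻¹' (φ ⁻¹' {i})).indicator fun p : ι × Ω => Y i p.2 := by
    ext p
    rw [Finset.sum_apply, Finset.sum_eq_single_of_mem (φ p.1) (φ.mem_range_self p.1)]
    · simp
    · intro i _ hi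
      simp [hi.symm]
  rw [hsum]
  exact Finset.aestronglyMeasurable_sum _ fun i _ =>
    (hY i).comp_snd.indicator (measurable_fst (φ.measurableSet_fiber i))

theorem aestronglyMeasurable_uncurry_of_ae_continuous [TopologicalSpace ι]
    [TopologicalSpace.MetrizableSpace ι] [SecondCountableTopology ι] [OpensMeasurableSpace ι]
    [SFinite P] (hY : ∀ i, AEStronglyMeasurable (Y i) P)
    (hc : ∀ᵐ ω ∂P, Continuous fun i => Y i ω) (ν : Measure ι) :
    AEStronglyMeasurable (Function.uncurry Y) (ν.prod P) := by
  have hid : StronglyMeasurable (id : ι → ι) := stronglyMeasurable_id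
  refine aestronglyMeasurable_of_tendsto_ae Filter.atTop
    (fun n => aestronglyMeasurable_comp_simpleFunc hY (hid.approx n) ν) ?_
  filter_upwards [Measure.quasiMeasurePreserving_snd.ae hc] with p hp
  exact (hp.tendsto p.1).comp (hid.tendsto_approx p.1)

end JointMeasurability

section SecondOrderProcess

theorem sq_integral_le {α : Type*} [MeasurableSpace α] {ν : Measure α} [IsFiniteMeasure ν]
    {f : α → ℝ} (hf : MemLp f 2 ν) : (∫ x, f x ∂ν) ^ 2 ≤ ν.real Set.univ * ∫ x, f x ^ 2 ∂ν := by
  rcases eq_or_ne ν 0 with rfl | hν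
  · simp
  have : NeZero ν := ⟨hν⟩
  have hjensen : (⨍ x, f x ∂ν) ^ 2 ≤ ⨍ x, f x ^ 2 ∂ν :=
    even_two.convexOn_pow.map_average_le (by fun_prop) isClosed_univ (by simp)
      (hf.integrable one_le_two) hf.integrable_sq
  simp only [average_eq, smul_eq_mul, mul_pow] at hjensen
  have hmass : 0 < ν.real Set.univ := measureReal_univ_pos
  field_simp at hjensen
  exact hjensen

variable {Ω : Type*} [MeasurableSpace Ω]

/-- A second-order process on the line with almost surely continuous paths and continuous second
moment; this is what makes it an element of `L²` on bounded time intervals. -/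
structure IsSecondOrderContinuous (Y : ℝ → Ω → ℝ) (P : Measure Ω) : Prop where
  memLp : ∀ u, MemLp (Y u) 2 P
  continuous_paths : ∀ᵐ ω ∂P, Continuous fun u => Y u ω
  continuous_integral_sq : Continuous fun u => ∫ ω, Y u ω ^ 2 ∂P

namespace IsSecondOrderContinuous

variable {P : Measure Ω} {Y : ℝ → Ω → ℝ} {Z : Ω → ℝ} {s t : ℝ}

theorem mul_left (hY : IsSecondOrderContinuous Y P) {g : ℝ → ℝ} (hg : Continuous g) :
    IsSecondOrderContinuous (fun u ω => g u * Y u ω) P where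
  memLp u := (hY.memLp u).const_mul (g u)
  continuous_paths := by
    filter_upwards [hY.continuous_paths] with ω hω using hg.mul hω
  continuous_integral_sq := by
    simp only [mul_pow, integral_const_mul]
    exact (hg.pow 2).mul hY.continuous_integral_sq

variable [IsFiniteMeasure P]

theorem memLp_uncurry (hY : IsSecondOrderContinuous Y P) (s t : ℝ) :
    MemLp (Function.uncurry Y) 2 ((volume.restrict (Set.Ioc s t)).prod P) := by
  have hmeas := aestronglyMeasurable_uncurry_of_ae_continuous
    (fun u => (hY.memLp u).aestronglyMeasurable) hY.continuous_paths
    (volume.restrict (Set.Ioc s t))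
  have hmeas_sq : AEStronglyMeasurable (fun p => Function.uncurry Y p ^ 2) _ := hmeas.pow 2
  rw [memLp_two_iff_integrable_sq hmeas, integrable_prod_iff hmeas_sq]
  refine ⟨.of_forall fun u => (hY.memLp u).integrable_sq, ?_⟩
  simp only [Function.uncurry_apply_pair, norm_pow, Real.norm_eq_abs, sq_abs]
  exact hY.continuous_integral_sq.integrableOn_Ioc

theorem memLp_intervalIntegral (hY : IsSecondOrderContinuous Y P) (hst : s ≤ t) :
    MemLp (fun ω => ∫ u in s..t, Y u ω) 2 P := by
  have hYL := hY.memLp_uncurry s t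
  have hint : Integrable (fun ω => ∫ u in Set.Ioc s t, Y u ω) P :=
    (hYL.integrable one_le_two).integral_prod_right
  simp only [intervalIntegral.integral_of_le hst]
  rw [memLp_two_iff_integrable_sq hint.aestronglyMeasurable]
  refine (hYL.integrable_sq.integral_prod_right.const_mul
    ((volume.restrict (Set.Ioc s t)).real Set.univ)).mono' (hint.aestronglyMeasurable.pow 2) ?_
  filter_upwards [hY.continuous_paths] with ω hω
  rw [Real.norm_of_nonneg (sq_nonneg _)]
  exact sq_integral_le ((memLp_two_iff_integrable_sq hω.aestronglyMeasurable).2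
    (hω.pow 2).integrableOn_Ioc)

theorem integral_intervalIntegral_mul (hY : IsSecondOrderContinuous Y P) (hZ : MemLp Z 2 P)
    (hst : s ≤ t) :
    ∫ ω, (∫ u in s..t, Y u ω) * Z ω ∂P = ∫ u in s..t, ∫ ω, Y u ω * Z ω ∂P := by
  simp only [intervalIntegral.integral_of_le hst, ← integral_mul_const]
  exact (integral_integral_swap ((hY.memLp_uncurry s t).integrable_mul (hZ.comp_snd _))).symm

theorem memLp_ouTransform (hY : IsSecondOrderContinuous Y P) (θ : ℝ) (hst : s ≤ t) :
    MemLp (fun ω => ouTransform θ s t (Y · ω)) 2 P :=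
  ((hY.memLp t).sub ((hY.memLp s).const_mul _)).sub
    (((hY.mul_left (by fun_prop)).memLp_intervalIntegral hst).const_mul θ)

theorem integral_ouTransform_mul (hY : IsSecondOrderContinuous Y P) (hZ : MemLp Z 2 P) (θ : ℝ)
    (hst : s ≤ t) :
    ∫ ω, ouTransform θ s t (Y · ω) * Z ω ∂P
      = ouTransform θ s t fun u => ∫ ω, Y u ω * Z ω ∂P := by
  have hweighted : IsSecondOrderContinuous (fun u ω => Real.exp (-θ * (t - u)) * Y u ω) P :=
    hY.mul_left (by fun_prop)
  have hYZ : ∀ u, Integrable (fun ω => Y u ω * Z ω) P := fun u => (hY.memLp u).integrable_mul hZ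
  have hint : Integrable (fun ω => (∫ u in s..t, Real.exp (-θ * (t - u)) * Y u ω) * Z ω) P :=
    (hweighted.memLp_intervalIntegral hst).integrable_mul hZ
  have hboundary : Integrable
      (fun ω => Y t ω * Z ω - Real.exp (-θ * (t - s)) * (Y s ω * Z ω)) P :=
    (hYZ t).sub ((hYZ s).const_mul _)
  have hswap := hweighted.integral_intervalIntegral_mul hZ hst
  simp only [mul_assoc, integral_const_mul] at hswap
  simp only [ouTransform, sub_mul, mul_assoc]
  rw [integral_sub hboundary (hint.const_mul θ), integral_sub (hYZ t) ((hYZ s).const_mul _),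
    integral_const_mul, integral_const_mul, hswap]

end IsSecondOrderContinuous

end SecondOrderProcess

section BifractionalCovariance

/-- The covariance function of bifractional Brownian motion with parameters `H` and `K`. -/
noncomputable def bifractionalCov (H K u v : ℝ) : ℝ :=
  1 / (2 : ℝ) ^ K * ((u ^ (2 * H) + v ^ (2 * H)) ^ K - |u - v| ^ (2 * H * K))

variable {θ H K s t s' t' : ℝ}

theorem continuous_bifractionalCov (hH : 0 ≤ H) (hK : 0 ≤ K) :
    Continuous (Function.uncurry (bifractionalCov H K)) :=
  ((continuous_add_rpow_rpow (by positivity) hK).sub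
    (continuous_abs_sub_rpow (by positivity))).const_mul _

theorem ouTransform₂_bifractionalCov (hH : 0 ≤ H) (hK : 0 ≤ K) :
    ouTransform₂ θ s t s' t' (bifractionalCov H K)
      = 1 / (2 : ℝ) ^ K * (ouTransform₂ θ s t s' t' (fun u v => (u ^ (2 * H) + v ^ (2 * H)) ^ K)
          - ouTransform₂ θ s t s' t' (fun u v => |u - v| ^ (2 * H * K))) := by
  rw [← ouTransform₂_sub (continuous_add_rpow_rpow (by positivity) hK)
    (continuous_abs_sub_rpow (by positivity)), ← ouTransform₂_const_mul]
  rfl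

theorem one_div_two_rpow_mem_Ioc (hK : 0 ≤ K) : 1 / (2 : ℝ) ^ K ∈ Set.Ioc 0 1 :=
  ⟨by positivity, div_le_one_of_le₀ (Real.one_le_rpow one_le_two hK) (by positivity)⟩

theorem ouTransform₂_bifractionalCov_le {M : ℝ} (hθ : 0 < θ) (hH : 0 ≤ H) (hK : 0 ≤ K)
    (hK1 : K ≤ 1) (hs : 0 ≤ s) (hst : s ≤ t) (hs' : 0 ≤ s') (hst' : s' ≤ t') (hM : 0 ≤ M)
    (h : -ouTransform₂ θ s t s' t' (fun u v => |u - v| ^ (2 * H * K)) ≤ M) :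
    ouTransform₂ θ s t s' t' (bifractionalCov H K) ≤ M := by
  obtain ⟨hc, hc1⟩ := one_div_two_rpow_mem_Ioc hK
  have hsum := ouTransform₂_add_rpow_rpow_nonpos (b := 2 * H) hθ (by positivity) hK hK1 hs hst
    hs' hst'
  rw [ouTransform₂_bifractionalCov hH hK]
  exact (mul_le_mul_of_nonneg_left (by linarith) hc.le).trans (mul_le_of_le_one_left hM hc1)

theorem ouTransform₂_bifractionalCov_self_le (hθ : 0 < θ) (hH : 0 < H) (hH1 : H ≤ 1)
    (hK : 0 < K) (hK1 : K ≤ 1) (ht : 0 ≤ t) :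
    ouTransform₂ θ 0 t 0 t (bifractionalCov H K) ≤ 3 * (1 + 2 / θ ^ 2) := by
  rcases ht.eq_or_lt with rfl | ht
  · have hzero : ouTransform₂ θ 0 0 0 0 (bifractionalCov H K) = 0 := by
      simp [ouTransform₂, ouTransform]
    rw [hzero]
    positivity
  · exact ouTransform₂_bifractionalCov_le hθ hH.le hK.le hK1 le_rfl ht.le le_rfl ht.le
      (by positivity) (neg_ouTransform₂_abs_sub_rpow_le hθ (by positivity) (by nlinarith) ht)

theorem ouTransform₂_bifractionalCov_le_of_gap {δ : ℝ} (hθ : 0 < θ) (hH : 0 ≤ H) (hH1 : H ≤ 1)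
    (hK : 0 ≤ K) (hK1 : K ≤ 1) (hδ : 0 < δ) (hs' : 0 ≤ s') (hst' : s' ≤ t') (hst : s ≤ t)
    (hgap : δ ≤ s - t') :
    ouTransform₂ θ s t s' t' (bifractionalCov H K) ≤ 2 / θ ^ 2 * δ ^ (2 * H * K - 2) :=
  ouTransform₂_bifractionalCov_le hθ hH hK hK1 (by linarith) hst hs' hst' (by positivity)
    ((neg_le_abs _).trans (abs_ouTransform₂_abs_sub_rpow_le hθ (by positivity) (by nlinarith) hδ
      hst hst' hgap))

theorem abs_ouTransform₂_bifractionalCov_sub_le (hθ : 0 < θ) (hH : 0 < H) (hH1 : H ≤ 1)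
    (hK : 0 < K) (hK1 : K ≤ 1) (ht : 0 < t) :
    |ouTransform₂ θ 0 t 0 t (bifractionalCov H K)
        - H * K * Real.Gamma (2 * H * K) / ((2 : ℝ) ^ (K - 1) * θ ^ (2 * H * K))|
      ≤ 260 / θ ^ 2 * t ^ (2 * H * K - 2) := by
  have ha : 0 < 2 * H * K := by positivity
  obtain ⟨hc, hc1⟩ := one_div_two_rpow_mem_Ioc hK.le
  have hlimit : H * K * Real.Gamma (2 * H * K) / ((2 : ℝ) ^ (K - 1) * θ ^ (2 * H * K))
      = 1 / (2 : ℝ) ^ K * (Real.Gamma (2 * H * K + 1) / θ ^ (2 * H * K)) := by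
    rw [Real.rpow_sub_one two_ne_zero, Real.Gamma_add_one ha.ne']
    field_simp
  have hsum := abs_ouTransform₂_add_rpow_rpow_le (b := 2 * H) hθ (by positivity) (by linarith)
    hK.le hK1 ht
  have hdiff := abs_neg_ouTransform₂_abs_sub_rpow_sub_le hθ ha (by nlinarith) ht
  rw [ouTransform₂_bifractionalCov hH.le hK.le, hlimit, ← mul_sub, abs_mul, abs_of_pos hc,
    sub_eq_add_neg (ouTransform₂ _ _ _ _ _ _), add_sub_assoc]
  refine (mul_le_of_le_one_left (abs_nonneg _) hc1).trans ?_
  refine (abs_add_le _ _).trans ((add_le_add hsum hdiff).trans_eq ?_)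
  ring

end BifractionalCovariance

section Langevin

theorem eq_ouTransform_of_langevin {θ : ℝ} {x g : ℝ≥0 → ℝ} (hx : Continuous x) (hx0 : x 0 = 0)
    (h : ∀ t : ℝ≥0, x t = -θ * (∫ s in (0 : ℝ)..(t : ℝ), x s.toNNReal) + g t) (t : ℝ≥0) :
    x t = ouTransform θ 0 t fun u => g u.toNNReal := by
  set F : ℝ → ℝ := fun u => ∫ s in (0 : ℝ)..u, x s.toNNReal with hF
  have hxc : Continuous fun u : ℝ => x u.toNNReal := hx.comp continuous_real_toNNReal
  have hFderiv : ∀ u, HasDerivAt F (x u.toNNReal) u := fun u =>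
    (hxc.integral_hasStrictDerivAt 0 u).hasDerivAt
  have hFc : Continuous F := continuous_iff_continuousAt.2 fun u => (hFderiv u).continuousAt
  have hg : ∀ u : ℝ≥0, g u = x u + θ * F u := fun u => by rw [h u]; ring
  have hgc : Continuous fun u : ℝ => g u.toNNReal := by
    simp only [hg]
    fun_prop
  have hderiv : ∀ u ∈ Set.uIcc (0 : ℝ) t, HasDerivAt (fun u => Real.exp (-θ * (t - u)) * F u)
      (Real.exp (-θ * (t - u)) * g u.toNNReal) u := fun u hu => by
    rw [Set.uIcc_of_le t.coe_nonneg] at hu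
    refine ((((hasDerivAt_id' u).const_sub (t : ℝ)).const_mul (-θ)).exp.mul
      (hFderiv u)).congr_deriv ?_
    rw [hg, Real.coe_toNNReal u hu.1]
    ring
  have hint := intervalIntegral.integral_eq_sub_of_hasDerivAt hderiv
    (Continuous.intervalIntegrable
      ((by fun_prop : Continuous fun u => Real.exp (-θ * (t - u))).mul hgc) _ _)
  rw [ouTransform, hint]
  simp [hg, hx0, hF]

end Langevin

section OrnsteinUhlenbeck

variable {Ω : Type*} [MeasurableSpace Ω] {P : Measure Ω} {θ H K : ℝ} {B G X : ℝ≥0 → Ω → ℝ}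

theorem IsBifractionalBrownianMotion.isSecondOrderContinuous (hH : 0 ≤ H) (hK : 0 ≤ K)
    (hB : IsBifractionalBrownianMotion H K B P) :
    IsSecondOrderContinuous (fun u => B u.toNNReal) P where
  memLp u := (hB.isGaussianProcess.hasGaussianLaw_eval u.toNNReal).memLp_two
  continuous_paths := by
    filter_upwards [hB.continuous_paths] with ω hω using hω.comp continuous_real_toNNReal
  continuous_integral_sq := by
    simp only [sq, hB.integral_mul]
    exact (continuous_bifractionalCov hH hK).comp (by fun_prop :
      Continuous fun u : ℝ => ((u.toNNReal : ℝ), (u.toNNReal : ℝ)))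

namespace IsOrnsteinUhlenbeck

theorem ae_eq_ouTransform (hX : IsOrnsteinUhlenbeck θ G X P) (t : ℝ≥0) :
    X t =ᵐ[P] fun ω => ouTransform θ 0 t fun u => G u.toNNReal ω := by
  filter_upwards [hX.initial, hX.continuous_paths, hX.integral_equation] with ω h0 hc heq
  exact eq_ouTransform_of_langevin hc h0 heq t

variable [IsFiniteMeasure P]

theorem memLp (hG : IsSecondOrderContinuous (fun u => G u.toNNReal) P)
    (hX : IsOrnsteinUhlenbeck θ G X P) (t : ℝ≥0) : MemLp (X t) 2 P :=
  (memLp_congr_ae (hX.ae_eq_ouTransform t)).2 (hG.memLp_ouTransform θ t.coe_nonneg)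

theorem integral_mul_eq_ouTransform {Z : Ω → ℝ}
    (hG : IsSecondOrderContinuous (fun u => G u.toNNReal) P) (hX : IsOrnsteinUhlenbeck θ G X P)
    (hZ : MemLp Z 2 P) (t : ℝ≥0) :
    ∫ ω, X t ω * Z ω ∂P = ouTransform θ 0 t fun u => ∫ ω, G u.toNNReal ω * Z ω ∂P := by
  rw [← hG.integral_ouTransform_mul hZ θ t.coe_nonneg]
  refine integral_congr_ae ?_
  filter_upwards [hX.ae_eq_ouTransform t] with ω hω
  rw [hω]

theorem integral_mul_eq_ouTransform₂ (hG : IsSecondOrderContinuous (fun u => G u.toNNReal) P)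
    (hX : IsOrnsteinUhlenbeck θ G X P) (t s : ℝ≥0) :
    ∫ ω, X t ω * X s ω ∂P
      = ouTransform₂ θ 0 t 0 s fun u v => ∫ ω, G v.toNNReal ω * G u.toNNReal ω ∂P := by
  rw [hX.integral_mul_eq_ouTransform hG (hX.memLp hG s), ouTransform₂]
  congr 1 with u
  simp only [mul_comm (G u.toNNReal _)]
  exact hX.integral_mul_eq_ouTransform hG (hG.memLp u) s

theorem integral_mul_eq_ouTransform₂_bifractionalCov (hH : 0 ≤ H) (hK : 0 ≤ K)
    (hB : IsBifractionalBrownianMotion H K B P) (hX : IsOrnsteinUhlenbeck θ B X P) (t s : ℝ≥0) :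
    ∫ ω, X t ω * X s ω ∂P = ouTransform₂ θ 0 t 0 s (bifractionalCov H K) := by
  rw [hX.integral_mul_eq_ouTransform₂ (hB.isSecondOrderContinuous hH hK)]
  refine ouTransform₂_congr t.coe_nonneg s.coe_nonneg fun u hu v hv => ?_
  rw [hB.integral_mul, Real.coe_toNNReal u hu.1, Real.coe_toNNReal v hv.1, bifractionalCov]

theorem abs_integral_sq_sub_le (hθ : 0 < θ) (hH : 0 < H) (hH1 : H ≤ 1) (hK : 0 < K)
    (hK1 : K ≤ 1) (hB : IsBifractionalBrownianMotion H K B P) (hX : IsOrnsteinUhlenbeck θ B X P)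
    {t : ℝ≥0} (ht : 0 < t) :
    |(∫ ω, X t ω ^ 2 ∂P)
        - H * K * Real.Gamma (2 * H * K) / ((2 : ℝ) ^ (K - 1) * θ ^ (2 * H * K))|
      ≤ 260 / θ ^ 2 * (t : ℝ) ^ (2 * H * K - 2) := by
  simp only [sq (X t _), hX.integral_mul_eq_ouTransform₂_bifractionalCov hH.le hK.le hB]
  exact abs_ouTransform₂_bifractionalCov_sub_le hθ hH hH1 hK hK1 ht

theorem integral_mul_le_of_bifractional (hθ : 0 < θ) (hH : 0 < H) (hH1 : H ≤ 1) (hK : 0 < K)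
    (hK1 : K ≤ 1) (hB : IsBifractionalBrownianMotion H K B P) (hX : IsOrnsteinUhlenbeck θ B X P)
    (t s : ℝ≥0) : ∫ ω, X t ω * X s ω ∂P ≤ 3 * (1 + 2 / θ ^ 2) := by
  have hL2 := fun r => hX.memLp (hB.isSecondOrderContinuous hH.le hK.le) r
  have hvar : ∀ r : ℝ≥0, ∫ ω, X r ω ^ 2 ∂P ≤ 3 * (1 + 2 / θ ^ 2) := fun r => by
    simp only [sq (X r _), hX.integral_mul_eq_ouTransform₂_bifractionalCov hH.le hK.le hB]
    exact ouTransform₂_bifractionalCov_self_le hθ hH hH1 hK hK1 r.coe_nonneg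
  have hamgm : ∫ ω, 2 * (X t ω * X s ω) ∂P ≤ ∫ ω, (X t ω ^ 2 + X s ω ^ 2) ∂P :=
    integral_mono (((hL2 t).integrable_mul (hL2 s)).const_mul 2)
      ((hL2 t).integrable_sq.add (hL2 s).integrable_sq)
      fun ω => by simpa only [mul_assoc] using two_mul_le_add_sq (X t ω) (X s ω)
  rw [integral_const_mul, integral_add (hL2 t).integrable_sq (hL2 s).integrable_sq] at hamgm
  linarith [hvar t, hvar s]

theorem integral_mul_le_rpow_sub (hθ : 0 < θ) (hH : 0 < H) (hH1 : H ≤ 1) (hK : 0 < K)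
    (hK1 : K ≤ 1) (hB : IsBifractionalBrownianMotion H K B P) (hX : IsOrnsteinUhlenbeck θ B X P)
    {s t : ℝ≥0} (hst : s < t) :
    ∫ ω, X t ω * X s ω ∂P
      ≤ (3 * (1 + 2 / θ ^ 2) * (1 + 8 / θ ^ 2) + 8 / θ ^ 2) * ((t : ℝ) - s) ^ (2 * H * K - 2) := by
  set m : ℝ≥0 := (s + t) / 2 with hm
  set d : ℝ := t - s with hd
  have hd0 : 0 < d := sub_pos.2 (NNReal.coe_lt_coe.2 hst)
  have hms : (m : ℝ) - s = d / 2 := by simp only [hm, hd]; push_cast; ring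
  have htm : (t : ℝ) - m = d / 2 := by linarith
  have ha : 0 ≤ 2 * H * K := by positivity
  have ha2 : 2 * H * K ≤ 2 := by nlinarith
  have hsplit : ∫ ω, X t ω * X s ω ∂P = Real.exp (-θ * (t - m)) * (∫ ω, X m ω * X s ω ∂P)
      + ouTransform₂ θ m t 0 s (bifractionalCov H K) := by
    simp only [hX.integral_mul_eq_ouTransform₂_bifractionalCov hH.le hK.le hB]
    exact ouTransform₂_split_left (continuous_bifractionalCov hH.le hK.le) m
  have hpast : Real.exp (-θ * (t - m)) * (∫ ω, X m ω * X s ω ∂P)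
      ≤ (1 + 8 / θ ^ 2) * d ^ (2 * H * K - 2) * (3 * (1 + 2 / θ ^ 2)) := by
    have hexp := exp_neg_mul_le_rpow_sub_two (half_pos hθ) ha ha2 hd0
    rw [show -(θ / 2) * d = -θ * (t - m) by rw [htm]; ring,
      show 2 / (θ / 2) ^ 2 = 8 / θ ^ 2 by field_simp; norm_num] at hexp
    exact (mul_le_mul_of_nonneg_left (hX.integral_mul_le_of_bifractional hθ hH hH1 hK hK1 hB m s)
      (Real.exp_pos _).le).trans (mul_le_mul_of_nonneg_right hexp (by positivity))
  have hrecent : ouTransform₂ θ m t 0 s (bifractionalCov H K)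
      ≤ 2 / θ ^ 2 * (4 * d ^ (2 * H * K - 2)) :=
    (ouTransform₂_bifractionalCov_le_of_gap hθ hH.le hH1 hK.le hK1 (half_pos hd0) le_rfl
      s.coe_nonneg (by linarith) hms.ge).trans
      (mul_le_mul_of_nonneg_left (half_rpow_sub_two_le ha hd0.le) (by positivity))
  rw [hsplit]
  refine (add_le_add hpast hrecent).trans_eq ?_
  ring

theorem integral_mul_le_abs_sub_rpow (hθ : 0 < θ) (hH : 0 < H) (hH1 : H ≤ 1) (hK : 0 < K)
    (hK1 : K ≤ 1) (hB : IsBifractionalBrownianMotion H K B P) (hX : IsOrnsteinUhlenbeck θ B X P)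
    {t s : ℝ≥0} (hts : t ≠ s) :
    ∫ ω, X t ω * X s ω ∂P
      ≤ (3 * (1 + 2 / θ ^ 2) * (1 + 8 / θ ^ 2) + 8 / θ ^ 2) *
          |(t : ℝ) - s| ^ (2 * H * K - 2) := by
  wlog hst : s < t generalizing s t
  · simpa only [abs_sub_comm, mul_comm (X t _)] using
      this hts.symm (lt_of_le_of_ne (not_lt.1 hst) hts)
  rw [abs_of_pos (sub_pos.2 (NNReal.coe_lt_coe.2 hst))]
  exact hX.integral_mul_le_rpow_sub hθ hH hH1 hK hK1 hB hst

end IsOrnsteinUhlenbeck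

end OrnsteinUhlenbeck

theorem theorem4p3_general (θ : ℝ) (hθ : 0 < θ) :
    ∃ C : ℝ, 0 < C ∧
      ∀ H K : ℝ, 0 < H → H ≤ 1 → 0 < K → K ≤ 1 →
      ∀ (Ω : Type*) [MeasurableSpace Ω] (P : Measure Ω) [IsProbabilityMeasure P]
        (B X : ℝ≥0 → Ω → ℝ),
        IsBifractionalBrownianMotion H K B P → IsOrnsteinUhlenbeck θ B X P →
        (∀ t : ℝ≥0, MemLp (X t) 2 P) ∧
        (∀ t : ℝ≥0, 0 < t →
          |(∫ ω, (X t ω) ^ 2 ∂P)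
              - H * K * Real.Gamma (2 * H * K) / ((2 : ℝ) ^ (K - 1) * θ ^ (2 * H * K))|
            ≤ C * (t : ℝ) ^ (2 * H * K - 2)) ∧
        (∀ t s : ℝ≥0, t ≠ s →
          ∫ ω, X t ω * X s ω ∂P ≤ C * |(t : ℝ) - (s : ℝ)| ^ (2 * H * K - 2)) := by
  have hC₁ : 0 < 260 / θ ^ 2 := by positivity
  have hC₂ : 0 < 3 * (1 + 2 / θ ^ 2) * (1 + 8 / θ ^ 2) + 8 / θ ^ 2 := by positivity
  refine ⟨_, add_pos hC₁ hC₂, fun H K hH hH1 hK hK1 Ω _ P _ B X hB hX =>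
    ⟨hX.memLp (hB.isSecondOrderContinuous hH.le hK.le), fun t ht => ?_, fun t s hts => ?_⟩⟩
  · exact (hX.abs_integral_sq_sub_le hθ hH hH1 hK hK1 hB ht).trans
      (mul_le_mul_of_nonneg_right (le_add_of_nonneg_right hC₂.le) (by positivity))
  · exact (hX.integral_mul_le_abs_sub_rpow hθ hH hH1 hK hK1 hB hts).trans
      (mul_le_mul_of_nonneg_right (le_add_of_nonneg_left hC₁.le) (by positivity))

theorem theorem4p3 (θ H : ℝ) (hθ : 0 < θ) (hH0 : 0 < H) (hH1 : H < 1) :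
    ∃ C : ℝ, 0 < C ∧
      ∀ K : ℝ, 0 < K → K < 1 → H * K ≠ 1 / 2 →
      ∀ (Ω : Type*) [MeasurableSpace Ω] (P : Measure Ω) [IsProbabilityMeasure P]
        (B X : ℝ≥0 → Ω → ℝ),
        IsBifractionalBrownianMotion H K B P → IsOrnsteinUhlenbeck θ B X P →
        (∀ t : ℝ≥0, MemLp (X t) 2 P) ∧
        (∀ t : ℝ≥0, 2 < t →
          |(∫ ω, (X t ω) ^ 2 ∂P)
              - H * K * Real.Gamma (2 * H * K) / ((2 : ℝ) ^ (K - 1) * θ ^ (2 * H * K))|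
            ≤ C * (t : ℝ) ^ (2 * H * K - 2)) ∧
        (∀ t s : ℝ≥0, 2 < |(t : ℝ) - (s : ℝ)| →
          ∫ ω, X t ω * X s ω ∂P
            ≤ C * (if H < 1 / 2 then |(t : ℝ) - (s : ℝ)| ^ (2 * H * K - 2 * H - 1)
                else |(t : ℝ) - (s : ℝ)| ^ (2 * H * K - 2))) := by
  obtain ⟨C, hC, hbounds⟩ := theorem4p3_general θ hθ
  refine ⟨C, hC, fun K hK hK1 _ Ω _ P _ B X hB hX => ?_⟩
  obtain ⟨hL2, hvar, hcov⟩ := hbounds H K hH0 hH1.le hK hK1.le Ω P B X hB hX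
  refine ⟨hL2, fun t ht => hvar t (two_pos.trans ht), fun t s hts => ?_⟩
  have hne : t ≠ s := by
    rintro rfl
    norm_num at hts
  refine (hcov t s hne).trans ?_
  gcongr
  split_ifs with hH
  · exact Real.rpow_le_rpow_of_exponent_le (by linarith) (by linarith)
  · exact le_rfl
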